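/- Let $G$ be a finite connected loopless graph, parallel edges allowed, of genus $g=|E(G)|-|V(G)|+1=2$, and let $u,v\in V(G)$. Divisors are elements of $\mathbb Z^{V(G)}$, $\sim$ is linear (chip-firing) equivalence, $|D|$ is the set of effective divisors linearly equivalent to $D$, and $r(D)\ge -1$ is the Baker–Norine rank, i.e. the largest integer $r\ge -1$ such that $|D-E|\ne\emptyset$ for every effective divisor $E$ of degree $r$. Put $\Delta(D)=r(D)-r(D-u)-r(D-v)+r(D-u-v)$. A divisor $D$ is submodular if $\Delta(D+au+bv)\ge 0$ for all $a,b\in\mathbb Z$. The transmission permutation of $D$, if it exists, is the unique bijection $\tau_D:\mathbb Z\to\mathbb Z$ such that for all $a,b\in\mathbb Z$, $\Delta(D+au-bv)$ equals $1$ if $\tau_D(b)=a$ and $0$ otherwise. For a bijection $\tau:\mathbb Z\to\mathbb Z$, $\operatorname{inv}_k(\tau)$ is the number of classes of pairs $(a,b)\in\mathbb Z^2$ with $a<b$ and $\tau(a)>\tau(b)$, where $(a,b)$ and $(a',b')$ are identified if $a-a'=b-b'\in k\mathbb Z$. Let $k$ be the torsion order of $(G,u,v)$, i.e. the order of the class $[u-v]$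 (the least integer $k\ge 1$ with $ku\sim kv$). Suppose that $(G,u,v)$ is rigidly marked: every divisor on $G$ is submodular and $r(u+v)=0$. Then $(G,u,v)$ has $k$-general transmission (that is, $ku\sim kv$, and every divisor $D$ is submodular, so that $\tau_D$ exists, and satisfies $\operatorname{inv}_k(\tau_D)\le g=2$) if and only if the class $[u-v]$ is non-recurrent (that is, for every $w\in V(G)$ there is at most one $n\in\{1,\dots,k-1\}$ with $|w+n(u-v)|\ne\emptyset$). -/

import Mathlib

open scoped Graph

noncomputable section

namespace Graph

variable {α β : Type*}

/-- A multigraph is connected if it has a vertex and any two vertices are joined by a path.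
This is a predicate on Mathlib's multigraphs, which may have parallel edges. -/
def IsConnected (G : Graph α β) : Prop :=
  V(G).Nonempty ∧ ∀ x ∈ V(G), ∀ y ∈ V(G), Relation.ReflTransGen G.Adj x y

/-- The genus (first Betti number) `|E(G)| - |V(G)| + 1` of a finite connected multigraph. -/
def genus (G : Graph α β) : ℤ :=
  (E(G).ncard : ℤ) - (V(G).ncard : ℤ) + 1

/-- Divisors: integer-valued functions on the (finite) vertex set, with pointwise addition. -/
abbrev Div (G : Graph α β) : Type _ := V(G) → ℤ

open Classical in
/-- The divisor consisting of one chip at the vertex `w`. -/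
def pt (G : Graph α β) (w : V(G)) : G.Div := fun x => if x = w then 1 else 0

/-- The number of edges joining `x` and `y`. -/
def edgeCount (G : Graph α β) (x y : V(G)) : ℕ := {e | G.IsLink e x y}.ncard

section

variable (G : Graph α β) [Fintype V(G)]

/-- The degree of a divisor. -/
def divDeg (D : G.Div) : ℤ := ∑ x, D x

/-- The graph Laplacian: every vertex `y` is fired `f y` times, and each firing of `y` sends one
chip along every edge at `y`. -/
def laplacian : G.Div →+ G.Div where
  toFun f := fun x => ∑ y, (G.edgeCount x y : ℤ) * (f y - f x)
  map_zero' := by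
    ext x
    simp
  map_add' f g := by
    ext x
    simp only [Pi.add_apply]
    rw [← Finset.sum_add_distrib]
    exact Finset.sum_congr rfl fun y _ => by ring

/-- The group of principal divisors. -/
def principal : AddSubgroup G.Div := G.laplacian.range

/-- The Picard group: divisors modulo linear equivalence. -/
abbrev Pic : Type _ := G.Div ⧸ G.principal

/-- The class of a divisor in the Picard group. -/
def cls (D : G.Div) : G.Pic := QuotientAddGroup.mk D

/-- Linear equivalence of divisors. -/
def LinEquiv (D D' : G.Div) : Prop := G.cls D = G.cls D'

/-- The complete linear system `|D|`: the effective divisors linearly equivalent to `D`. -/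
def linearSystem (D : G.Div) : Set G.Div := {E | 0 ≤ E ∧ G.LinEquiv E D}

/-- The rank of a divisor: the largest integer `r ≥ -1` such that `|D - E|` is nonempty for every
effective divisor `E` of degree `r`. The condition is vacuous for `r = -1`, and it fails for
`r > max (deg D) (-1)`, so this is the maximum of a nonempty set that is bounded above. -/
def rank (D : G.Div) : ℤ :=
  sSup {r : ℤ | -1 ≤ r ∧
    ∀ E : G.Div, 0 ≤ E → G.divDeg E = r → (G.linearSystem (D - E)).Nonempty}

/-- `Δ(D) = r(D) - r(D-u) - r(D-v) + r(D-u-v)`. -/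
def rankDelta (u v : V(G)) (D : G.Div) : ℤ :=
  G.rank D - G.rank (D - G.pt u) - G.rank (D - G.pt v) + G.rank (D - G.pt u - G.pt v)

/-- `D` is submodular with respect to `u, v`: `Δ` is nonnegative on all twists of `D`. -/
def IsSubmodular (u v : V(G)) (D : G.Div) : Prop :=
  ∀ a b : ℤ, 0 ≤ G.rankDelta u v (D + a • G.pt u + b • G.pt v)

/-- `τ` is the transmission permutation of `D` on `(G, u, v)`. -/
def IsTransmissionPerm (u v : V(G)) (D : G.Div) (τ : Equiv.Perm ℤ) : Prop :=
  ∀ a b : ℤ, (if τ b = a then 1 else 0) = G.rankDelta u v (D + a • G.pt u - b • G.pt v)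

/-- A divisor has at most one transmission permutation. -/
theorem IsTransmissionPerm.unique {u v : V(G)} {D : G.Div} {τ σ : Equiv.Perm ℤ}
    (hτ : G.IsTransmissionPerm u v D τ) (hσ : G.IsTransmissionPerm u v D σ) : τ = σ := by
  ext b
  have h := (hτ (τ b) b).trans (hσ (τ b) b).symm
  by_contra hne
  have hne' : ¬ σ b = τ b := fun h' => hne h'.symm
  simp [hne'] at h

/-- The torsion order of `(G, u, v)`: the order of the class `[u - v]`. -/
def torsionOrder (u v : V(G)) : ℕ := addOrderOf (G.cls (G.pt u - G.pt v))

end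

/-- The inversions of a permutation of `ℤ`: pairs `a < b` with `τ a > τ b`. -/
abbrev Inversion (τ : Equiv.Perm ℤ) : Type := {p : ℤ × ℤ // p.1 < p.2 ∧ τ p.1 > τ p.2}

/-- `k`-equivalence of inversions: they differ by a translation by a multiple of `k`. -/
def inversionSetoid (k : ℕ) (τ : Equiv.Perm ℤ) : Setoid (Inversion τ) where
  r p q := p.1.1 - q.1.1 = p.1.2 - q.1.2 ∧ (k : ℤ) ∣ p.1.1 - q.1.1
  iseqv :=
    { refl := fun p => by simp
      symm := fun {p q} h => ⟨by omega, by
        have := (dvd_neg (a := (k : ℤ))).mpr h.2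
        rwa [neg_sub] at this⟩
      trans := fun {p q s} h h' => ⟨by omega, by
        have := dvd_add h.2 h'.2
        rwa [sub_add_sub_cancel] at this⟩ }

/-- The set `Inv_k(τ)` of `k`-inversions: `k`-equivalence classes of inversions. -/
abbrev KInversion (k : ℕ) (τ : Equiv.Perm ℤ) : Type := Quotient (inversionSetoid k τ)

section

variable (G : Graph α β) [Fintype V(G)]

/-- `(G, u, v)` has `k`-general transmission: `k u ∼ k v`, every divisor is submodular, and the
transmission permutation of every divisor exists and has (finitely many and) at most `genus G`
many `k`-inversions. -/
def HasGeneralTransmission (u v : V(G)) (k : ℕ) : Prop :=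
  0 < k ∧ G.LinEquiv (k • G.pt u) (k • G.pt v) ∧
    ∀ D : G.Div, G.IsSubmodular u v D ∧
      ∃ τ : Equiv.Perm ℤ, G.IsTransmissionPerm u v D τ ∧
        Finite (KInversion k τ) ∧ (Nat.card (KInversion k τ) : ℤ) ≤ G.genus

/-- `(G, u, v)` is rigidly marked: every divisor is submodular and `r(u + v) = 0`. -/
def IsRigidlyMarked (u v : V(G)) : Prop :=
  (∀ D : G.Div, G.IsSubmodular u v D) ∧ G.rank (G.pt u + G.pt v) = 0

/-- Non-recurrence of the class of `D`, which is meant for divisors of degree `0`: if `k` is the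
order of `[D]`, then for every vertex `w` there is at most one integer `n` in `{1, …, k - 1}`
with `|nD + w|` nonempty. -/
def IsNonRecurrent (D : G.Div) : Prop :=
  ∀ w : V(G), {n : ℕ | 1 ≤ n ∧ n < addOrderOf (G.cls D) ∧
    (G.linearSystem (n • D + G.pt w)).Nonempty}.Subsingleton

end

end Graph

end

/-! With `d = deg D`, tabulate the rank `X b j` of the degree-`j` twist `D + (b + j - d) u - b v`.
Dhar's burning argument makes every class of degree at least 2 effective, and `r(u + v) = 0`
supplies a noneffective class of degree 1. Hence only the entries in degrees 0, 1, 2 vary, each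
between two values. The second differences of the table are the values of `Δ`. They are nonnegative
and sum to 1 on every row and every antidiagonal, so they form the matrix of a permutation, which is
`τ_D`.

The key point is a bijection between inversions of `τ_D` and integers `b` with `X b 1 = 0`. The
shifted permutation `σ = τ_D + d - 2` moves no integer by more than 2. An inversion `(m, n)` is sent
to a place `b` with `m < b ≤ n` and `σ n < b ≤ σ m` (`inversion_crossing`, `crossing_unique`,
`exists_inversion`). The table is `k`-periodic in `b`, so `inv_k(τ_D)` counts the residues `b` mod
`k` whose degree-one twist is effective.

These twists differ by multiples of `u - v`. If one is effective, it is equivalent to a vertex `w`,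
and the others are `w + n(u - v)`. The residue `n = 0` always counts, so `inv_k ≤ 2` for all `D`
says exactly that each `w` admits at most one further `n` in `{1, …, k - 1}`. -/

namespace Graph

variable {α β : Type*} {G : Graph α β}

/-! ### Reduced divisors and effectivity in degree at least the genus -/

theorem edgeCount_comm (x y : V(G)) : G.edgeCount x y = G.edgeCount y x := by
  simp only [edgeCount, isLink_comm]

theorem edgeCount_pos [Finite E(G)] {x y : V(G)} (h : G.Adj x y) : 0 < G.edgeCount x y := by
  obtain ⟨e, he⟩ := h
  have hfin : {e | G.IsLink e x y}.Finite :=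
    (Set.toFinite E(G)).subset fun e he => IsLink.edge_mem he
  exact (Set.ncard_pos hfin).2 ⟨e, he⟩

variable [Fintype V(G)]

/-- Handshake: every edge is counted by at most two ordered pairs of vertices. -/
theorem sum_edgeCount_le [Finite E(G)] :
    ∑ x : V(G), ∑ y : V(G), G.edgeCount x y ≤ 2 * E(G).ncard := by
  classical
  have := Fintype.ofFinite E(G)
  have key : ∀ x y : V(G), G.edgeCount x y = ∑ e : E(G), if G.IsLink e x y then 1 else 0 := by
    intro x y
    rw [Finset.sum_boole, Nat.cast_id, edgeCount, ← Set.ncard_coe_finset,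
      ← Set.ncard_image_of_injective _ Subtype.val_injective]
    congr 1
    ext e
    simp only [Set.mem_ofPred_eq, Finset.coe_filter, Finset.mem_univ, true_and, Set.mem_image,
      Subtype.exists, exists_and_left, exists_prop, exists_eq_right_right]
    exact ⟨fun h => ⟨h, h.edge_mem⟩, fun h => h.1⟩
  simp only [key]
  rw [← Finset.sum_product', Finset.sum_comm, ← Nat.card_coe_set_eq, Nat.card_eq_fintype_card,
    mul_comm, ← smul_eq_mul, ← Finset.card_univ]
  refine Finset.sum_le_card_nsmul _ _ _ fun e _ => ?_
  obtain ⟨a, b, hab⟩ := G.exists_isLink_of_mem_edgeSet e.2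
  rw [Finset.sum_boole, Nat.cast_id]
  refine (Finset.card_le_card
    (t := {((⟨a, hab.left_mem⟩ : V(G)), (⟨b, hab.right_mem⟩ : V(G))),
      (⟨b, hab.right_mem⟩, ⟨a, hab.left_mem⟩)}) ?_).trans Finset.card_le_two
  rintro ⟨x, y⟩ h
  simp only [Finset.mem_filter] at h
  rcases hab.eq_and_eq_or_eq_and_eq h.2 with ⟨h1, h2⟩ | ⟨h1, h2⟩
  · simp [h1, h2]
  · simp [h1, h2]

/-- In a connected graph there is a function that grows towards `q`: every other vertex has a
neighbour where it is larger. -/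
theorem IsConnected.exists_height (h : G.IsConnected) (q : V(G)) :
    ∃ f : V(G) → ℕ, ∀ x, x ≠ q → ∃ y : V(G), G.Adj x y ∧ f x < f y := by
  let S : SimpleGraph V(G) := SimpleGraph.fromRel fun x y => G.Adj x y
  have hr : ∀ x y, S.Reachable x y := by
    have aux : ∀ x y : α, Relation.ReflTransGen G.Adj x y → ∀ (hx : x ∈ V(G)) (hy : y ∈ V(G)),
        S.Reachable ⟨x, hx⟩ ⟨y, hy⟩ := by
      intro x y hxy hx
      induction hxy with
      | refl => exact fun _ => SimpleGraph.Reachable.refl _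
      | @tail b c _ hbc ih =>
        intro hc
        refine (ih hbc.left_mem).trans ?_
        by_cases hne : b = c
        · subst hne
          exact SimpleGraph.Reachable.refl _
        · refine SimpleGraph.Adj.reachable ?_
          simp only [S, SimpleGraph.fromRel_adj]
          exact ⟨fun e => hne (congrArg Subtype.val e), Or.inl hbc⟩
    exact fun x y => aux x y (h.2 x x.2 y y.2) x.2 y.2
  obtain ⟨N, hN⟩ := (Set.finite_range fun x => S.dist x q).bddAbove
  -- The height is minus the distance to `q`, shifted by a bound `N` so that the natural subtraction
  -- never truncates.
  refine ⟨fun x => N - S.dist x q, fun x hx => ?_⟩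
  have hle : ∀ y, S.dist y q ≤ N := fun y => hN ⟨y, rfl⟩
  obtain ⟨p, hp⟩ := (hr x q).exists_walk_length_eq_dist
  cases p with
  | nil => exact absurd rfl hx
  | @cons _ y _ hxy p =>
    refine ⟨y, ?_, ?_⟩
    · simp only [S, SimpleGraph.fromRel_adj] at hxy
      exact hxy.2.elim id Adj.symm
    · have h1 := SimpleGraph.dist_le p
      rw [SimpleGraph.Walk.length_cons] at hp
      have h2 := hle x
      have h3 := hle y
      show N - S.dist x q < N - S.dist y q
      omega

/-- In a connected graph there is an integer function that is strictly subharmonic outside `q`. -/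
theorem IsConnected.exists_laplacian_pos [Finite E(G)] (h : G.IsConnected) (q : V(G)) :
    ∃ f : G.Div, (∀ x, f x ≤ f q) ∧ ∀ x, x ≠ q → 0 < G.laplacian f x := by
  classical
  obtain ⟨f, hf⟩ := h.exists_height q
  have hmax : ∀ x, f x ≤ f q := by
    obtain ⟨z, -, hz⟩ := Finset.exists_max_image Finset.univ f ⟨q, Finset.mem_univ q⟩
    by_cases hzq : z = q
    · subst hzq
      exact fun x => hz x (Finset.mem_univ x)
    · obtain ⟨y, -, hy⟩ := hf z hzq
      exact absurd (hz y (Finset.mem_univ y)) (by omega)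
  -- `M` exceeds every valency. In `M ^ f`, one higher neighbour gains at least `(M - 1) * M ^ f x`,
  -- while the other edges, at most `M - 2` of them, each lose at most `M ^ f x`.
  let M : ℤ := 1 + ∑ x : V(G), ∑ y : V(G), (G.edgeCount x y : ℤ)
  have hM : 1 ≤ M := by
    have : (0 : ℤ) ≤ ∑ x : V(G), ∑ y : V(G), (G.edgeCount x y : ℤ) := by positivity
    omega
  refine ⟨fun x => M ^ f x, fun x => pow_le_pow_right₀ hM (hmax x), fun x hx => ?_⟩
  obtain ⟨y, hxy, hlt⟩ := hf x hx
  show 0 < ∑ y, (G.edgeCount x y : ℤ) * (M ^ f y - M ^ f x)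
  have hpos : 0 < M ^ f x := by positivity
  have h1 : ∑ z ∈ Finset.univ.erase y, (G.edgeCount x z : ℤ) * (0 - M ^ f x) ≤
      ∑ z ∈ Finset.univ.erase y, (G.edgeCount x z : ℤ) * (M ^ f z - M ^ f x) := by
    refine Finset.sum_le_sum fun z _ => ?_
    gcongr
    positivity
  have h2 : M ^ f x * M ≤ M ^ f y := by
    rw [← pow_succ]
    exact pow_le_pow_right₀ hM hlt
  have h3 : (1 : ℤ) ≤ G.edgeCount x y := by exact_mod_cast edgeCount_pos hxy
  have h4 : ∑ z : V(G), (G.edgeCount x z : ℤ) < M := by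
    have := Finset.single_le_sum (f := fun x : V(G) => ∑ y : V(G), (G.edgeCount x y : ℤ))
      (fun i _ => by positivity) (Finset.mem_univ x)
    simp only [M]
    linarith
  rw [← Finset.add_sum_erase _ _ (Finset.mem_univ y)] at h4 ⊢
  rw [← Finset.sum_mul] at h1
  have h5 : M ^ f x * M - M ^ f x ≤ G.edgeCount x y * (M ^ f y - M ^ f x) := by
    have : 0 ≤ M ^ f y - M ^ f x := by nlinarith
    nlinarith
  nlinarith

/-- The Laplacian is self-adjoint. -/
theorem sum_mul_laplacian (f g : G.Div) :
    ∑ x, f x * G.laplacian g x = ∑ x, g x * G.laplacian f x := by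
  have key : ∀ f g : G.Div, ∑ x, f x * G.laplacian g x =
      ∑ x, ∑ y, (G.edgeCount x y : ℤ) * (f x * g y) -
        ∑ x, ∑ y, (G.edgeCount x y : ℤ) * (f x * g x) := by
    intro f g
    rw [← Finset.sum_sub_distrib]
    refine Finset.sum_congr rfl fun x _ => ?_
    rw [← Finset.sum_sub_distrib]
    show f x * ∑ y, (G.edgeCount x y : ℤ) * (g y - g x) = _
    rw [Finset.mul_sum]
    exact Finset.sum_congr rfl fun y _ => by ring
  rw [key, key]
  congr 1
  · rw [Finset.sum_comm]
    refine Finset.sum_congr rfl fun x _ => Finset.sum_congr rfl fun y _ => ?_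
    rw [edgeCount_comm]
    ring
  · simp only [mul_comm (f _)]

theorem divDeg_laplacian (f : G.Div) : G.divDeg (G.laplacian f) = 0 := by
  have := sum_mul_laplacian (fun _ => 1) f
  simpa [divDeg, laplacian] using this

theorem linEquiv_iff {D D' : G.Div} : G.LinEquiv D D' ↔ ∃ f, D' = D + G.laplacian f := by
  rw [LinEquiv, cls, cls, QuotientAddGroup.eq, principal, AddMonoidHom.mem_range]
  refine exists_congr fun f => ?_
  rw [neg_add_eq_sub, eq_sub_iff_add_eq, add_comm, eq_comm]

theorem divDeg_add (D D' : G.Div) : G.divDeg (D + D') = G.divDeg D + G.divDeg D' :=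
  Finset.sum_add_distrib

theorem LinEquiv.divDeg_eq {D D' : G.Div} (h : G.LinEquiv D D') : G.divDeg D = G.divDeg D' := by
  obtain ⟨f, rfl⟩ := linEquiv_iff.1 h
  rw [divDeg_add, divDeg_laplacian, add_zero]

/-- Every divisor is equivalent to one that is nonnegative and reduced outside `q`: no nonempty
set of vertices avoiding `q` can be fired. -/
theorem IsConnected.exists_reduced [Finite E(G)] [DecidableEq V(G)] (h : G.IsConnected)
    (q : V(G)) (D : G.Div) :
    ∃ D', G.LinEquiv D D' ∧ (∀ x, x ≠ q → 0 ≤ D' x) ∧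
      ∀ S : Finset V(G), q ∉ S → S.Nonempty →
        ∃ x ∈ S, D' x < ∑ y ∈ Sᶜ, (G.edgeCount x y : ℤ) := by
  obtain ⟨f, hf, hpos⟩ := h.exists_laplacian_pos q
  -- The reduced divisor is one that maximises the pairing with `f` among the equivalent divisors
  -- nonnegative outside `q`; the maximum exists because `f` is largest at `q`.
  let P : ℤ → Prop := fun s => ∃ D', G.LinEquiv D D' ∧ (∀ x, x ≠ q → 0 ≤ D' x) ∧
    ∑ x, f x * D' x = s
  have hne : ∃ s, P s := by
    let t : ℤ := ∑ x, |D x|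
    refine ⟨_, D + G.laplacian (t • f), linEquiv_iff.2 ⟨_, rfl⟩, fun x hx => ?_, rfl⟩
    rw [map_zsmul, Pi.add_apply, Pi.smul_apply, smul_eq_mul]
    have h1 : |D x| ≤ t := Finset.single_le_sum (f := fun x => |D x|)
      (fun i _ => abs_nonneg _) (Finset.mem_univ x)
    have h2 := neg_abs_le (D x)
    have h3 := abs_nonneg (D x)
    have h4 := hpos x hx
    nlinarith
  have hbd : ∃ b, ∀ s, P s → s ≤ b := by
    refine ⟨f q * G.divDeg D, ?_⟩
    rintro _ ⟨D', hD', hnn, rfl⟩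
    rw [hD'.divDeg_eq, divDeg, Finset.mul_sum]
    refine Finset.sum_le_sum fun x _ => ?_
    by_cases hx : x = q
    · rw [hx]
    · exact mul_le_mul_of_nonneg_right (hf x) (hnn x hx)
  obtain ⟨s, ⟨D', hD', hnn, hs⟩, hmax⟩ := Int.exists_greatest_of_bdd hbd hne
  refine ⟨D', hD', hnn, fun S hq hS => ?_⟩
  by_contra! hfire
  let g : G.Div := fun x => if x ∈ S then 1 else 0
  have hg : ∀ x, G.laplacian g x =
      ∑ y, (G.edgeCount x y : ℤ) * ((if y ∈ S then 1 else 0) - if x ∈ S then 1 else 0) :=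
    fun x => rfl
  have hP : P (∑ x, f x * (D' + G.laplacian g) x) := by
    obtain ⟨e, rfl⟩ := linEquiv_iff.1 hD'
    refine ⟨_, linEquiv_iff.2 ⟨e + g, ?_⟩, fun x hx => ?_, rfl⟩
    · rw [map_add, add_assoc]
    · rw [Pi.add_apply, hg]
      by_cases hxS : x ∈ S
      · have := hfire x hxS
        have e1 : ∑ y, (G.edgeCount x y : ℤ) * ((if y ∈ S then 1 else 0) - if x ∈ S then 1 else 0)
            = - ∑ y ∈ Sᶜ, (G.edgeCount x y : ℤ) := by
          rw [← Finset.sum_neg_distrib, ← Finset.sum_add_sum_compl S,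
            Finset.sum_eq_zero, zero_add]
          · refine Finset.sum_congr rfl fun y hy => ?_
            rw [if_neg (Finset.mem_compl.1 hy), if_pos hxS]
            ring
          · intro y hy
            rw [if_pos hy, if_pos hxS, sub_self, mul_zero]
        rw [e1]
        linarith
      · refine add_nonneg (hnn x hx) (Finset.sum_nonneg fun y _ => ?_)
        rw [if_neg hxS, sub_zero]
        split_ifs <;> simp
  have hlt := hmax _ hP
  simp only [Pi.add_apply, mul_add, Finset.sum_add_distrib] at hlt
  -- By self-adjointness, firing `S` changes the pairing by the sum of `G.laplacian f` over `S`,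
  -- which is positive since `q ∉ S`.
  rw [hs, sum_mul_laplacian] at hlt
  have : 0 < ∑ x, g x * G.laplacian f x := by
    simp only [g, ite_mul, one_mul, zero_mul]
    rw [Finset.sum_ite_mem, Finset.univ_inter]
    exact Finset.sum_pos (fun x hx => hpos x fun e => hq (e ▸ hx)) hS
  omega

/-- Dhar's burning bound for the number of chips of a reduced divisor outside `q`. -/
theorem two_mul_sum_reduced_le [DecidableEq V(G)] {q : V(G)} {D : G.Div}
    (h : ∀ S : Finset V(G), q ∉ S → S.Nonempty →
      ∃ x ∈ S, D x < ∑ y ∈ Sᶜ, (G.edgeCount x y : ℤ)) (S : Finset V(G)) (hq : q ∉ S) :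
    2 * ∑ x ∈ S, D x ≤ ∑ x, ∑ y, (G.edgeCount x y : ℤ) -
      ∑ x ∈ Sᶜ, ∑ y ∈ Sᶜ, (G.edgeCount x y : ℤ) - 2 * S.card := by
  induction S using Finset.strongInduction with
  | H S ih =>
    rcases S.eq_empty_or_nonempty with rfl | hS
    · simp
    -- Fire spreads from `Sᶜ` to `x`, which holds fewer chips than it has burning edges; the strict
    -- inequality yields the 2 per vertex.
    · obtain ⟨x, hx, hlt⟩ := h S hq hS
      have := ih (S.erase x) (Finset.erase_ssubset hx) fun hm => hq (Finset.mem_of_mem_erase hm)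
      have hc : (S.erase x)ᶜ = insert x Sᶜ := by
        rw [Finset.compl_erase]
      have hxc : x ∉ Sᶜ := by simpa using hx
      rw [hc, Finset.sum_insert hxc] at this
      simp only [Finset.sum_insert hxc, Finset.sum_add_distrib] at this
      rw [← Finset.add_sum_erase S _ hx]
      have hcard := Finset.card_erase_add_one hx
      have hsymm : ∑ y ∈ Sᶜ, (G.edgeCount y x : ℤ) = ∑ y ∈ Sᶜ, (G.edgeCount x y : ℤ) :=
        Finset.sum_congr rfl fun y _ => by rw [edgeCount_comm]
      rw [hsymm] at this
      have h0 : (0 : ℤ) ≤ G.edgeCount x x := by positivity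
      have hcard' : (S.card : ℤ) = (S.erase x).card + 1 := by exact_mod_cast hcard.symm
      linarith

/-- On a connected graph every divisor of degree at least the genus is equivalent to an effective
divisor. -/
theorem IsConnected.linearSystem_nonempty [Finite E(G)] (h : G.IsConnected) {D : G.Div}
    (hD : G.genus ≤ G.divDeg D) : (G.linearSystem D).Nonempty := by
  classical
  obtain ⟨q, hq⟩ := h.1
  obtain ⟨D', hD', hnn, hred⟩ := h.exists_reduced ⟨q, hq⟩ D
  refine ⟨D', fun x => ?_, hD'.symm⟩
  by_cases hx : x = ⟨q, hq⟩
  · subst hx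
    -- Everything except `q` burns, so at most `|E| - |V| + 1 = g` chips lie outside `q`, and the
    -- degree forces `D' q ≥ 0`.
    have h1 := two_mul_sum_reduced_le hred (Finset.univ.erase ⟨q, hq⟩) (by simp)
    have h2 := sum_edgeCount_le (G := G)
    have h3 : ∑ x : V(G), ∑ y : V(G), (G.edgeCount x y : ℤ) ≤ 2 * E(G).ncard := by
      exact_mod_cast h2
    have h4 : (0 : ℤ) ≤ ∑ x ∈ (Finset.univ.erase (⟨q, hq⟩ : V(G)))ᶜ,
      ∑ y ∈ (Finset.univ.erase ⟨q, hq⟩)ᶜ, (G.edgeCount x y : ℤ) := by positivity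
    have h5 : ((Finset.univ.erase (⟨q, hq⟩ : V(G))).card : ℤ) + 1 = V(G).ncard := by
      rw [← Nat.card_coe_set_eq, Nat.card_eq_fintype_card]
      exact_mod_cast Finset.card_erase_add_one (Finset.mem_univ _)
    rw [hD'.divDeg_eq, divDeg, ← Finset.add_sum_erase _ _ (Finset.mem_univ ⟨q, hq⟩), genus] at hD
    rw [Pi.zero_apply]
    linarith
  · exact hnn x hx

end Graph

/-! ### Combinatorics of rank tables and their permutations -/

/-- The second difference of a function tabulating the ranks of the twists of a divisor. -/
def rankCell (X : ℤ → ℤ → ℤ) (b j : ℤ) : ℤ :=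
  X b j - X b (j - 1) - X (b + 1) (j - 1) + X (b + 1) (j - 2)

/-- The properties of the table `X b j = r(D + (b + j - d) u - b v)`, `d = deg D`, of the ranks of
the twists of a divisor on a rigidly marked graph of genus two. The entry `X b j` is the rank of a
divisor of degree `j`. -/
structure IsRankTable (X : ℤ → ℤ → ℤ) : Prop where
  neg : ∀ b j, j < 0 → X b j = -1
  zero : ∀ b, X b 0 = -1 ∨ X b 0 = 0
  one : ∀ b, X b 1 = -1 ∨ X b 1 = 0
  two : ∀ b, X b 2 = 0 ∨ X b 2 = 1
  large : ∀ b j, 3 ≤ j → X b j = j - 2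
  mono_left : ∀ b j, X b j ≤ X b (j + 1)
  mono_right : ∀ b j, X (b + 1) j ≤ X b (j + 1)
  lip_left : ∀ b j, X b (j + 1) ≤ X b j + 1
  lip_right : ∀ b j, X b (j + 1) ≤ X (b + 1) j + 1
  cell_nonneg : ∀ b j, 0 ≤ rankCell X b j
  rigid : ∀ b, X (b + 1) 0 = 0 → X b 2 = 0

namespace IsRankTable

variable {X : ℤ → ℤ → ℤ}

theorem cell_values (h : IsRankTable X) (b : ℤ) :
    rankCell X b 0 = X b 0 + 1 ∧
    rankCell X b 1 = X b 1 - X b 0 - X (b + 1) 0 - 1 ∧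
    rankCell X b 2 = X b 2 - X b 1 - X (b + 1) 1 + X (b + 1) 0 ∧
    rankCell X b 3 = 1 - X b 2 - X (b + 1) 2 + X (b + 1) 1 ∧
    rankCell X b 4 = X (b + 1) 2 := by
  have h1 := h.neg b (-1) (by norm_num)
  have h2 := h.neg (b + 1) (-1) (by norm_num)
  have h3 := h.neg (b + 1) (-2) (by norm_num)
  have h4 := h.large b 3 (by norm_num)
  have h5 := h.large b 4 (by norm_num)
  have h6 := h.large (b + 1) 3 (by norm_num)
  refine ⟨?_, ?_, ?_, ?_, ?_⟩ <;> norm_num [rankCell] <;> omega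

theorem cell_eq_zero (h : IsRankTable X) {b j : ℤ} (hj : j < 0 ∨ 4 < j) : rankCell X b j = 0 := by
  unfold rankCell
  rcases hj with hj | hj
  · rw [h.neg b j hj, h.neg b (j - 1) (by omega), h.neg (b + 1) (j - 1) (by omega),
      h.neg (b + 1) (j - 2) (by omega)]
    norm_num
  · rw [h.large b j (by omega), h.large b (j - 1) (by omega), h.large (b + 1) (j - 1) (by omega),
      h.large (b + 1) (j - 2) (by omega)]
    omega

/-- Every row of the table of second differences contains exactly one `1`, and otherwise `0`. -/
theorem exists_cell_eq (h : IsRankTable X) (b : ℤ) :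
    ∃ i, 0 ≤ i ∧ i ≤ 4 ∧ ∀ j, rankCell X b j = if j = i then 1 else 0 := by
  obtain ⟨c0, c1, c2, c3, c4⟩ := h.cell_values b
  have n0 := h.cell_nonneg b 0
  have n1 := h.cell_nonneg b 1
  have n2 := h.cell_nonneg b 2
  have n3 := h.cell_nonneg b 3
  have n4 := h.cell_nonneg b 4
  have key : ∃ i, 0 ≤ i ∧ i ≤ 4 ∧ ∀ j, 0 ≤ j → j ≤ 4 → rankCell X b j = if j = i then 1 else 0 := by
    -- The five formulas of `cell_values` telescope to 1.
    have : rankCell X b 0 = 1 ∨ rankCell X b 1 = 1 ∨ rankCell X b 2 = 1 ∨ rankCell X b 3 = 1 ∨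
      rankCell X b 4 = 1 := by omega
    rcases this with e | e | e | e | e
    · refine ⟨0, by norm_num, by norm_num, fun j hj hj' => ?_⟩
      interval_cases j <;> norm_num <;> omega
    · refine ⟨1, by norm_num, by norm_num, fun j hj hj' => ?_⟩
      interval_cases j <;> norm_num <;> omega
    · refine ⟨2, by norm_num, by norm_num, fun j hj hj' => ?_⟩
      interval_cases j <;> norm_num <;> omega
    · refine ⟨3, by norm_num, by norm_num, fun j hj hj' => ?_⟩
      interval_cases j <;> norm_num <;> omega
    · refine ⟨4, by norm_num, by norm_num, fun j hj hj' => ?_⟩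
      interval_cases j <;> norm_num <;> omega
  obtain ⟨i, hi, hi', H⟩ := key
  refine ⟨i, hi, hi', fun j => ?_⟩
  by_cases hj : 0 ≤ j ∧ j ≤ 4
  · exact H j hj.1 hj.2
  · rw [h.cell_eq_zero (by omega), if_neg (by omega)]

/-- Every antidiagonal of the table of second differences contains exactly one `1`. -/
theorem exists_unique_antidiagonal (h : IsRankTable X) (c : ℤ) :
    ∃! b, rankCell X b (c - b) = 1 := by
  obtain ⟨a0, a1, a2, a3, a4⟩ := h.cell_values c
  obtain ⟨b0, b1, b2, b3, b4⟩ := h.cell_values (c - 1)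
  obtain ⟨c0, c1, c2, c3, c4⟩ := h.cell_values (c - 2)
  obtain ⟨d0, d1, d2, d3, d4⟩ := h.cell_values (c - 3)
  obtain ⟨e0, e1, e2, e3, e4⟩ := h.cell_values (c - 4)
  have n0 := h.cell_nonneg c 0
  have n1 := h.cell_nonneg (c - 1) 1
  have n2 := h.cell_nonneg (c - 2) 2
  have n3 := h.cell_nonneg (c - 3) 3
  have n4 := h.cell_nonneg (c - 4) 4
  have z1 : c - 1 + 1 = c := by ring
  have z2 : c - 2 + 1 = c - 1 := by ring
  have z3 : c - 3 + 1 = c - 2 := by ring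
  have z4 : c - 4 + 1 = c - 3 := by ring
  simp only [z1, z2, z3, z4] at *
  -- The same telescoping, now along the antidiagonal.
  have sum : rankCell X c 0 + rankCell X (c - 1) 1 + rankCell X (c - 2) 2 + rankCell X (c - 3) 3 +
    rankCell X (c - 4) 4 = 1 := by omega
  clear a0 a1 a2 a3 a4 b0 b1 b2 b3 b4 c0 c1 c2 c3 c4 d0 d1 d2 d3 d4 e0 e1 e2 e3 e4 z1 z2 z3 z4
  have inj : ∀ i j, 0 ≤ i → i ≤ 4 → 0 ≤ j → j ≤ 4 → rankCell X (c - i) i = 1 →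
      rankCell X (c - j) j = 1 → i = j := by
    obtain ⟨y, hy⟩ : ∃ y : ℤ → ℤ, ∀ i, rankCell X (c - i) i = y i := ⟨_, fun _ => rfl⟩
    have hy0 := hy 0
    rw [sub_zero] at hy0
    simp only [hy, hy0] at *
    intro i j hi hi' hj hj' ei ej
    clear hy hy0
    interval_cases i <;> interval_cases j <;> omega
  have uniq : ∀ i, 0 ≤ i → i ≤ 4 → rankCell X (c - i) i = 1 → ∀ b, rankCell X b (c - b) = 1 →
      b = c - i := by
    intro i hi hi' e b hb
    have hj : 0 ≤ c - b ∧ c - b ≤ 4 := by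
      by_contra hj
      rw [h.cell_eq_zero (by omega)] at hb
      omega
    have := inj i (c - b) hi hi' hj.1 hj.2 e (by rwa [sub_sub_cancel])
    omega
  have : rankCell X c 0 = 1 ∨ rankCell X (c - 1) 1 = 1 ∨ rankCell X (c - 2) 2 = 1 ∨
    rankCell X (c - 3) 3 = 1 ∨ rankCell X (c - 4) 4 = 1 := by omega
  have fin : ∀ i, 0 ≤ i → i ≤ 4 → rankCell X (c - i) i = 1 → ∃! b, rankCell X b (c - b) = 1 :=
    fun i hi hi' e => ⟨c - i, by simpa using e, uniq i hi hi' e⟩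
  rcases this with e | e | e | e | e
  · exact fin 0 (by norm_num) (by norm_num) (by simpa using e)
  · exact fin 1 (by norm_num) (by norm_num) e
  · exact fin 2 (by norm_num) (by norm_num) e
  · exact fin 3 (by norm_num) (by norm_num) e
  · exact fin 4 (by norm_num) (by norm_num) e

/-- The second differences of a rank table are the graph of a permutation. -/
theorem exists_perm (h : IsRankTable X) (d : ℤ) :
    ∃ τ : Equiv.Perm ℤ, ∀ a b, (if τ b = a then 1 else 0) = rankCell X b (a - b + d) := by
  choose i hi hi' H using h.exists_cell_eq
  have bij : Function.Bijective fun b => b + i b - d := by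
    rw [Function.bijective_iff_existsUnique]
    intro a
    obtain ⟨b, hb, ub⟩ := h.exists_unique_antidiagonal (a + d)
    have key : ∀ b, rankCell X b (a + d - b) = 1 ↔ b + i b - d = a := by
      intro b
      rw [H]
      split_ifs <;> simp <;> omega
    exact ⟨b, (key b).1 hb, fun y hy => ub y ((key y).2 hy)⟩
  refine ⟨Equiv.ofBijective _ bij, fun a b => ?_⟩
  rw [H, Equiv.ofBijective_apply]
  congr 1
  simp only [eq_iff_iff]
  constructor <;> intro <;> omega

/-- The local description of the permutation given by a rank table. -/
theorem perm_cases (h : IsRankTable X) {d : ℤ} {τ : Equiv.Perm ℤ}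
    (hτ : ∀ a b, (if τ b = a then 1 else 0) = rankCell X b (a - b + d)) (b : ℤ) :
    (τ b = b - d ∧ X b 0 = 0) ∨
    (τ b = b - d + 1 ∧ X b 0 = -1 ∧ X b 1 = 0 ∧ X (b + 1) 0 = -1) ∨
    (τ b = b - d + 2 ∧ X b 0 = -1 ∧ X b 2 - X b 1 - X (b + 1) 1 + X (b + 1) 0 = 1) ∨
    (τ b = b - d + 3 ∧ X b 2 = 0 ∧ X (b + 1) 2 = 0 ∧ X (b + 1) 1 = 0) ∨
    (τ b = b - d + 4 ∧ X (b + 1) 2 = 1) := by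
  obtain ⟨c0, c1, c2, c3, c4⟩ := h.cell_values b
  obtain ⟨i, hi, hi', H⟩ := h.exists_cell_eq b
  have e := hτ (τ b) b
  rw [if_pos rfl, H] at e
  have e' : τ b - b + d = i := by
    by_contra hne
    simp [hne] at e
  have H0 := H 0
  have e1 := H i
  rw [if_pos rfl] at e1
  have s0 := h.zero (b + 1)
  have s1 := h.one (b + 1)
  clear e H hτ
  interval_cases i
  · exact Or.inl (by omega)
  · have t1 := h.one b
    norm_num at H0
    exact Or.inr (Or.inl (by omega))
  · norm_num at H0
    exact Or.inr (Or.inr (Or.inl (by omega)))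
  · have t2 := h.two b
    have s2 := h.two (b + 1)
    exact Or.inr (Or.inr (Or.inr (Or.inl (by omega))))
  · exact Or.inr (Or.inr (Or.inr (Or.inr (by omega))))

/-- A degree-zero twist of rank 0 is trivial. Its neighbours in degree 1 are then single chips, the
cell in degree 1 forbids a second trivial twist next to it, and the twist in degree 2 at `b - 1` is
`u + v`. -/
theorem zero_adjacent (h : IsRankTable X) {b : ℤ} (hb : X b 0 = 0) :
    X b 1 = 0 ∧ X (b - 1) 1 = 0 ∧ X (b + 1) 0 = -1 ∧ X (b - 1) 2 = 0 := by
  have h1 := h.mono_left b 0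
  have h2 := h.mono_right (b - 1) 0
  have h3 := h.rigid (b - 1)
  have h4 := (h.cell_values b).2.1
  have h5 := h.cell_nonneg b 1
  have h6 := h.one b
  have h7 := h.one (b - 1)
  have h8 := h.zero (b + 1)
  norm_num at h1 h2 h3
  exact ⟨by omega, by omega, by omega, h3 hb⟩

/-- The mirror image of `zero_adjacent`, for degree-two twists of rank 1; the cell in degree 3
replaces the one in degree 1. -/
theorem two_adjacent (h : IsRankTable X) {b : ℤ} (hb : X b 2 = 1) :
    X b 1 = 0 ∧ X (b + 1) 1 = 0 ∧ X (b + 1) 2 = 0 ∧ X (b + 1) 0 = -1 := by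
  have h1 := h.lip_left b 1
  have h2 := h.lip_right b 1
  have h3 := h.rigid b
  have h4 := (h.cell_values b).2.2.2.1
  have h5 := h.cell_nonneg b 3
  have h6 := h.one b
  have h7 := h.one (b + 1)
  have h8 := h.zero (b + 1)
  have h9 := h.two (b + 1)
  norm_num at h1 h2
  refine ⟨by omega, by omega, by omega, ?_⟩
  rcases h8 with h8 | h8
  · exact h8
  · have := h3 h8
    omega

/-- An inversion of the permutation of a rank table crosses exactly one place. -/
theorem inversion_crossing (h : IsRankTable X) {d : ℤ} {τ : Equiv.Perm ℤ}
    (hτ : ∀ a b, (if τ b = a then 1 else 0) = rankCell X b (a - b + d)) {m n b : ℤ}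
    (hmn : m < n) (hinv : τ m > τ n) (hb : b = min n (τ m + d - 2)) :
    m < b ∧ b ≤ n ∧ τ n + d - 2 < b ∧ b ≤ τ m + d - 2 ∧ X b 1 = 0 := by
  have cm := h.perm_cases hτ m
  have cn := h.perm_cases hτ n
  obtain ⟨g, rfl⟩ : ∃ g, n = m + g := ⟨n - m, by ring⟩
  -- The displacement of `τ` lies between `-d` and `-d + 4`, so inverted positions are less than 4
  -- apart.
  have hg : g ≤ 3 := by omega
  have hg' : 1 ≤ g := by omega
  have t0 := h.zero_adjacent (b := m + g)
  have t1 := h.two_adjacent (b := m + 1)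
  have hz := h.zero (m + g)
  clear hτ
  interval_cases g
  · have t2 := h.two_adjacent (b := m)
    have t3 := h.zero_adjacent (b := m + 1 + 1)
    norm_num at t0 t3
    have hb' : b = m + 1 := by omega
    subst hb'
    clear hb
    omega
  · have e : m + 2 - 1 = m + 1 := by ring
    have e' : m + 1 + 1 = m + 2 := by ring
    rw [e] at t0
    rw [e'] at t1
    have hb' : b = m + 1 ∨ b = m + 2 := by omega
    rcases hb' with rfl | rfl <;> omega
  · have e : m + 3 - 1 = m + 2 := by ring
    have e' : m + 1 + 1 = m + 2 := by ring
    rw [e] at t0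
    rw [e'] at t1
    have hb' : b = m + 2 := by omega
    subst hb'
    omega

/-- The inversion crossing a given place is unique. -/
theorem crossing_unique (h : IsRankTable X) {d : ℤ} {τ : Equiv.Perm ℤ}
    (hτ : ∀ a b, (if τ b = a then 1 else 0) = rankCell X b (a - b + d)) {m n m' n' b : ℤ}
    (h1 : m < b ∧ b ≤ n ∧ τ n + d - 2 < b ∧ b ≤ τ m + d - 2)
    (h2 : m' < b ∧ b ≤ n' ∧ τ n' + d - 2 < b ∧ b ≤ τ m' + d - 2) : m = m' ∧ n = n' := by
  have c := h.perm_cases hτ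
  have cm := c m
  have cn := c n
  have cm' := c m'
  have cn' := c n'
  -- `τ + d - 2` moves integers by at most 2, leaving two candidates for each end. The outer ones
  -- need `X (b + 1) 0 = 0` and `X (b - 1) 2 = 1`, and these exclude the inner ones.
  have hn : n = b ∨ n = b + 1 := by omega
  have hn' : n' = b ∨ n' = b + 1 := by omega
  have hm : m = b - 1 ∨ m = b - 2 := by omega
  have hm' : m' = b - 1 ∨ m' = b - 2 := by omega
  have t0 := h.zero_adjacent (b := b)
  have t1 := h.two_adjacent (b := b - 1)
  have e1 : b - 2 + 1 = b - 1 := by ring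
  clear hτ c
  constructor
  · rcases hm with rfl | rfl <;> rcases hm' with rfl | rfl <;>
      simp only [e1, sub_add_cancel] at * <;> omega
  · rcases hn with rfl | rfl <;> rcases hn' with rfl | rfl <;> omega

theorem perm_eq_of_cell {d : ℤ} {τ : Equiv.Perm ℤ}
    (hτ : ∀ a b, (if τ b = a then 1 else 0) = rankCell X b (a - b + d)) {b j : ℤ}
    (hj : rankCell X b j = 1) : τ b = b - d + j := by
  have := hτ (b - d + j) b
  rw [show b - d + j - b + d = j by ring, hj] at this
  by_contra hne
  rw [if_neg hne] at this
  exact zero_ne_one this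

/-- At every place where the degree one twist is effective there is a crossing inversion. -/
theorem exists_inversion (h : IsRankTable X) {d : ℤ} {τ : Equiv.Perm ℤ}
    (hτ : ∀ a b, (if τ b = a then 1 else 0) = rankCell X b (a - b + d)) {b : ℤ}
    (hb : X b 1 = 0) : ∃ m n, m < n ∧ τ m > τ n ∧ b = min n (τ m + d - 2) := by
  have hn : (X (b + 1) 0 = 0 ∧ τ (b + 1) = b + 1 - d + 0) ∨ τ b = b - d + 0 ∨ τ b = b - d + 1 := by
    obtain ⟨c0, c1, -⟩ := h.cell_values b
    have n0 := h.cell_nonneg b 0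
    have n1 := h.cell_nonneg b 1
    rcases h.zero (b + 1) with z | z
    · have : rankCell X b 0 = 1 ∨ rankCell X b 1 = 1 := by omega
      exact Or.inr (this.imp (perm_eq_of_cell hτ) (perm_eq_of_cell hτ))
    · refine Or.inl ⟨z, perm_eq_of_cell hτ ?_⟩
      rw [(h.cell_values (b + 1)).1, z, zero_add]
  have hm : (X (b - 1) 2 = 1 ∧ τ (b - 2) = b - 2 - d + 4) ∨ τ (b - 1) = b - 1 - d + 3 ∨
      (X b 2 = 1 ∧ τ (b - 1) = b - 1 - d + 4) := by
    obtain ⟨-, -, -, c3, c4⟩ := h.cell_values (b - 1)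
    have n3 := h.cell_nonneg (b - 1) 3
    have n4 := h.cell_nonneg (b - 1) 4
    rw [sub_add_cancel] at c3 c4
    rcases h.two (b - 1) with z | z
    · have : rankCell X (b - 1) 3 = 1 ∨ rankCell X (b - 1) 4 = 1 := by omega
      exact Or.inr (this.imp (perm_eq_of_cell hτ) fun e => ⟨by omega, perm_eq_of_cell hτ e⟩)
    · refine Or.inl ⟨z, perm_eq_of_cell hτ ?_⟩
      rw [(h.cell_values (b - 2)).2.2.2.2, show b - 2 + 1 = b - 1 by ring, z]
  -- Rigidity rules out `τ (b + 1) + d - 2 = b - 1` together with `τ (b - 1) + d - 2 = b + 1`. That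
  -- inversion would also cross `b + 1`, and the minimum would be `b + 1` instead of `b`.
  have rg := h.rigid b
  rcases hn with hn | hn <;> rcases hm with hm | hm
  · exact ⟨b - 2, b + 1, by omega, by omega, by omega⟩
  · exact ⟨b - 1, b + 1, by omega, by omega, by omega⟩
  · exact ⟨b - 2, b, by omega, by omega, by omega⟩
  · exact ⟨b - 1, b, by omega, by omega, by omega⟩

end IsRankTable

/-- Periodicity of the table makes `τ` commute with translation by `k`, so the place of an inversion
descends to a residue mod `k`. -/
theorem IsRankTable.exists_kInversion_map {X : ℤ → ℤ → ℤ} (h : IsRankTable X) {d : ℤ}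
    {τ : Equiv.Perm ℤ}
    (hτ : ∀ a b, (if τ b = a then 1 else 0) = rankCell X b (a - b + d)) {k : ℕ}
    (hper : ∀ b j t, X (b + k * t) j = X b j) :
    ∃ f : Graph.KInversion k τ → ZMod k, Function.Injective f ∧
      Set.range f = (fun b : ℤ => (b : ZMod k)) '' {b | X b 1 = 0} := by
  have hshift : ∀ b t, τ (b + k * t) = τ b + k * t := by
    intro b t
    have e := hτ (τ b) b
    rw [if_pos rfl] at e
    have : rankCell X (b + k * t) (τ b - b + d) = 1 := by
      rw [e]
      simp only [rankCell, add_right_comm b (k * t : ℤ) 1, hper]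
    rw [IsRankTable.perm_eq_of_cell hτ this]
    ring
  let place : Graph.Inversion τ → ℤ := fun p => min p.1.2 (τ p.1.1 + d - 2)
  have hplace : ∀ p q : Graph.Inversion τ, Graph.inversionSetoid k τ p q →
      (place p : ZMod k) = place q := by
    rintro ⟨⟨m, n⟩, hp⟩ ⟨⟨m', n'⟩, hq⟩ ⟨h1, t, h2⟩
    simp only at h1 h2
    obtain rfl : m = m' + k * t := by omega
    obtain rfl : n = n' + k * t := by omega
    rw [ZMod.intCast_eq_intCast_iff_dvd_sub]
    refine ⟨-t, ?_⟩
    simp only [place, hshift]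
    rw [show τ m' + k * t + d - 2 = τ m' + d - 2 + k * t by ring, min_add_add_right]
    ring
  refine ⟨Quotient.lift (fun p => (place p : ZMod k)) hplace, ?_, ?_⟩
  · rintro ⟨p⟩ ⟨q⟩ hpq
    obtain ⟨⟨m, n⟩, hp⟩ := p
    obtain ⟨⟨m', n'⟩, hq⟩ := q
    obtain ⟨t, ht⟩ := (ZMod.intCast_eq_intCast_iff_dvd_sub _ _ _).1 hpq
    simp only [place] at ht
    have c := h.inversion_crossing hτ hp.1 hp.2 rfl
    have c' := h.inversion_crossing hτ hq.1 hq.2 rfl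
    have hs := hshift m t
    have hs' := hshift n t
    simp only at c c'
    obtain ⟨rfl, rfl⟩ := h.crossing_unique hτ (m := m + k * t) (n := n + k * t) (m' := m')
      (n' := n') (b := min n' (τ m' + d - 2)) (by omega) (by omega)
    refine Quotient.sound ⟨?_, -t, ?_⟩
    · simp
    · simp
  · ext z
    constructor
    · rintro ⟨⟨p⟩, rfl⟩
      exact ⟨place p, (h.inversion_crossing hτ p.2.1 p.2.2 rfl).2.2.2.2, rfl⟩
    · rintro ⟨b, hb, rfl⟩
      obtain ⟨m, n, hmn, hinv, e⟩ := h.exists_inversion hτ hb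
      exact ⟨Quotient.mk _ ⟨(m, n), hmn, hinv⟩, congrArg (Int.cast : ℤ → ZMod k) e.symm⟩

/-! ### Ranks of divisors in genus two -/

namespace Graph

variable {α β : Type*} {G : Graph α β}

theorem pt_nonneg (w : V(G)) : 0 ≤ G.pt w := by
  intro x
  unfold pt
  split_ifs <;> simp

variable [Fintype V(G)]

theorem divDeg_sub (D D' : G.Div) : G.divDeg (D - D') = G.divDeg D - G.divDeg D' :=
  Finset.sum_sub_distrib ..

theorem divDeg_zsmul (n : ℤ) (D : G.Div) : G.divDeg (n • D) = n * G.divDeg D := by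
  simp [divDeg, Finset.mul_sum]

theorem divDeg_pt (w : V(G)) : G.divDeg (G.pt w) = 1 := by
  simp [divDeg, pt]

theorem divDeg_nonneg {E : G.Div} (hE : 0 ≤ E) : 0 ≤ G.divDeg E :=
  Finset.sum_nonneg fun x _ => hE x

theorem eq_zero_of_divDeg_eq_zero {E : G.Div} (hE : 0 ≤ E) (h : G.divDeg E = 0) : E = 0 := by
  ext x
  exact (Finset.sum_eq_zero_iff_of_nonneg fun x _ => hE x).1 h x (Finset.mem_univ x)

/-- An effective divisor of positive degree has a chip at some vertex. -/
theorem exists_pt_le {E : G.Div} (hE : 0 ≤ E) (h : 0 < G.divDeg E) :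
    ∃ w, 0 ≤ E - G.pt w := by
  obtain ⟨w, -, hw⟩ := Finset.exists_lt_of_sum_lt
    (show ∑ _x : V(G), (0 : ℤ) < ∑ x, E x by rw [Finset.sum_const_zero]; exact h)
  refine ⟨w, fun x => ?_⟩
  have := hE x
  simp only [Pi.zero_apply, Pi.sub_apply, pt] at *
  split_ifs with hx
  · subst hx
    omega
  · omega

theorem LinEquiv.linearSystem_eq {D D' : G.Div} (h : G.LinEquiv D D') :
    G.linearSystem D = G.linearSystem D' := by
  unfold LinEquiv at h
  simp only [linearSystem, LinEquiv, h]

theorem LinEquiv.sub_right {D D' : G.Div} (h : G.LinEquiv D D') (E : G.Div) :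
    G.LinEquiv (D - E) (D' - E) := by
  change G.cls D - G.cls E = G.cls D' - G.cls E
  rw [show G.cls D = G.cls D' from h]

theorem LinEquiv.sub_left {D D' : G.Div} (h : G.LinEquiv D D') (E : G.Div) :
    G.LinEquiv (E - D) (E - D') := by
  change G.cls E - G.cls D = G.cls E - G.cls D'
  rw [show G.cls D = G.cls D' from h]

theorem LinEquiv.rank_eq {D D' : G.Div} (h : G.LinEquiv D D') : G.rank D = G.rank D' := by
  unfold rank
  simp only [(h.sub_right _).linearSystem_eq]

theorem linearSystem_add_nonempty {D E : G.Div} (h : (G.linearSystem D).Nonempty) (hE : 0 ≤ E) :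
    (G.linearSystem (D + E)).Nonempty := by
  obtain ⟨F, hF, hFD⟩ := h
  refine ⟨F + E, add_nonneg hF hE, ?_⟩
  change G.cls F + G.cls E = G.cls D + G.cls E
  rw [show G.cls F = G.cls D from hFD]

theorem divDeg_nonneg_of_nonempty {D : G.Div} (h : (G.linearSystem D).Nonempty) :
    0 ≤ G.divDeg D := by
  obtain ⟨F, hF, hFD⟩ := h
  rw [← LinEquiv.divDeg_eq hFD]
  exact divDeg_nonneg hF

theorem le_rank_iff [Nonempty V(G)] {D : G.Div} {r : ℤ} (hr : -1 ≤ r) :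
    r ≤ G.rank D ↔ ∀ E : G.Div, 0 ≤ E → G.divDeg E = r → (G.linearSystem (D - E)).Nonempty := by
  obtain ⟨q⟩ := ‹Nonempty V(G)›
  have hbd : BddAbove {r : ℤ | -1 ≤ r ∧
      ∀ E : G.Div, 0 ≤ E → G.divDeg E = r → (G.linearSystem (D - E)).Nonempty} := by
    refine ⟨max (G.divDeg D) 0, fun r hr => ?_⟩
    by_contra! hlt
    rw [max_lt_iff] at hlt
    have h1 := hr.2 (r • G.pt q) (smul_nonneg hlt.2.le (pt_nonneg q))
      (by rw [divDeg_zsmul, divDeg_pt, mul_one])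
    have h2 := divDeg_nonneg_of_nonempty h1
    rw [divDeg_sub, divDeg_zsmul, divDeg_pt] at h2
    omega
  refine ⟨fun h E hE hEr => ?_, fun h => le_csSup hbd ⟨hr, h⟩⟩
  have hmem := Int.csSup_mem (s := {r : ℤ | -1 ≤ r ∧
      ∀ E : G.Div, 0 ≤ E → G.divDeg E = r → (G.linearSystem (D - E)).Nonempty})
    ⟨-1, le_rfl, fun E hE hdeg => by have := divDeg_nonneg hE; omega⟩ hbd
  -- A test divisor of degree `r` is padded with chips at `q` up to degree `G.rank D`, where the
  -- supremum is attained.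
  have h0 : 0 ≤ (G.rank D - r) • G.pt q := smul_nonneg (by omega) (pt_nonneg q)
  have := hmem.2 (E + (G.rank D - r) • G.pt q) (add_nonneg hE h0)
    (by rw [divDeg_add, divDeg_zsmul, divDeg_pt, hEr, rank]; ring)
  have := linearSystem_add_nonempty this h0
  rwa [← sub_sub, sub_add_cancel] at this

variable [Nonempty V(G)]

theorem neg_one_le_rank (D : G.Div) : -1 ≤ G.rank D :=
  (le_rank_iff le_rfl).2 fun E hE hdeg => by
    have := divDeg_nonneg hE
    omega

theorem zero_le_rank_iff {D : G.Div} : 0 ≤ G.rank D ↔ (G.linearSystem D).Nonempty := by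
  rw [le_rank_iff (by norm_num)]
  refine ⟨fun h => by simpa using h 0 le_rfl (by simp [divDeg]), fun h E hE hdeg => ?_⟩
  rwa [eq_zero_of_divDeg_eq_zero hE hdeg, sub_zero]

theorem rank_le_rank_add_pt (D : G.Div) (w : V(G)) : G.rank D ≤ G.rank (D + G.pt w) := by
  refine (le_rank_iff (neg_one_le_rank D)).2 fun E hE hdeg => ?_
  rw [add_sub_right_comm]
  exact linearSystem_add_nonempty ((le_rank_iff (neg_one_le_rank D)).1 le_rfl E hE hdeg)
    (pt_nonneg w)

theorem rank_add_pt_le (D : G.Div) (w : V(G)) : G.rank (D + G.pt w) ≤ G.rank D + 1 := by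
  by_cases h : G.rank (D + G.pt w) = -1
  · have := neg_one_le_rank D
    omega
  · have h1 := neg_one_le_rank (D + G.pt w)
    suffices G.rank (D + G.pt w) - 1 ≤ G.rank D by omega
    refine (le_rank_iff (by omega)).2 fun E hE hdeg => ?_
    have := (le_rank_iff h1).1 le_rfl (E + G.pt w) (add_nonneg hE (pt_nonneg w))
      (by rw [divDeg_add, divDeg_pt, hdeg]; ring)
    rwa [add_sub_add_right_eq_sub] at this

theorem rank_of_divDeg_neg {D : G.Div} (h : G.divDeg D < 0) : G.rank D = -1 := by
  have h1 := neg_one_le_rank D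
  by_contra hne
  have := divDeg_nonneg_of_nonempty (zero_le_rank_iff.1 (by omega : 0 ≤ G.rank D))
  omega

theorem rank_of_divDeg_eq_zero {D : G.Div} (h : G.divDeg D = 0) :
    G.rank D = -1 ∨ G.rank D = 0 := by
  obtain ⟨q⟩ := ‹Nonempty V(G)›
  have h1 := neg_one_le_rank D
  have h2 := rank_add_pt_le (D - G.pt q) q
  rw [sub_add_cancel, rank_of_divDeg_neg (D := D - G.pt q)
    (by rw [divDeg_sub, divDeg_pt]; omega)] at h2
  omega

/-- The degree one divisor classes on a graph of genus two are not all effective. -/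
def HasNoneffective (G : Graph α β) [Fintype V(G)] : Prop :=
  ∃ D : G.Div, G.divDeg D = 1 ∧ ¬ (G.linearSystem D).Nonempty

section GenusTwo

variable [Finite E(G)]

/-- Rank 1 in degree 1 would make all vertices equivalent. For a noneffective `N` of degree 1, an
effective divisor equivalent to `N + q` contains some `w ∼ q`, and removing it would make `N`
effective. -/
theorem rank_of_divDeg_eq_one (hc : G.IsConnected) (hg : G.genus = 2) (hN : G.HasNoneffective)
    {D : G.Div} (h : G.divDeg D = 1) : G.rank D = -1 ∨ G.rank D = 0 := by
  have h1 := neg_one_le_rank D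
  suffices ¬ 1 ≤ G.rank D by omega
  intro h2
  rw [le_rank_iff (by norm_num)] at h2
  have hpt : ∀ w, G.cls (G.pt w) = G.cls D := by
    intro w
    obtain ⟨F, hF, hFD⟩ := h2 (G.pt w) (pt_nonneg w) (divDeg_pt w)
    have hdeg := LinEquiv.divDeg_eq hFD
    rw [divDeg_sub, divDeg_pt, h, sub_self] at hdeg
    rw [eq_zero_of_divDeg_eq_zero hF hdeg] at hFD
    exact (sub_eq_zero.1 (Eq.symm hFD : G.cls D - G.cls (G.pt w) = 0)).symm
  obtain ⟨N, hN1, hN2⟩ := hN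
  obtain ⟨q⟩ := ‹Nonempty V(G)›
  have hdeg2 : G.divDeg (N + G.pt q) = 2 := by rw [divDeg_add, divDeg_pt, hN1]; rfl
  obtain ⟨F, hF, hFN⟩ := hc.linearSystem_nonempty (D := N + G.pt q) (by rw [hg, hdeg2])
  obtain ⟨w, hw⟩ := exists_pt_le hF (by rw [LinEquiv.divDeg_eq hFN, hdeg2]; norm_num)
  refine hN2 ⟨_, hw, ?_⟩
  change G.cls F - G.cls (G.pt w) = G.cls N
  rw [show G.cls F = G.cls N + G.cls (G.pt q) from hFN, hpt, hpt, add_sub_cancel_right]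

theorem rank_of_divDeg_eq_two (hc : G.IsConnected) (hg : G.genus = 2) (hN : G.HasNoneffective)
    {D : G.Div} (h : G.divDeg D = 2) : G.rank D = 0 ∨ G.rank D = 1 := by
  obtain ⟨q⟩ := ‹Nonempty V(G)›
  have h0 := zero_le_rank_iff.2 (hc.linearSystem_nonempty (D := D) (by omega))
  have h1 := rank_add_pt_le (D - G.pt q) q
  have h2 := rank_of_divDeg_eq_one hc hg hN (D := D - G.pt q) (by rw [divDeg_sub, divDeg_pt, h]; rfl)
  rw [sub_add_cancel] at h1
  omega

theorem rank_of_three_le_divDeg (hc : G.IsConnected) (hg : G.genus = 2) (hN : G.HasNoneffective)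
    {D : G.Div} (h : 3 ≤ G.divDeg D) : G.rank D = G.divDeg D - 2 := by
  have hle : G.divDeg D - 2 ≤ G.rank D := by
    refine (le_rank_iff (by omega)).2 fun E hE hdeg => hc.linearSystem_nonempty ?_
    rw [divDeg_sub, hdeg, hg]
    omega
  suffices ¬ G.divDeg D - 1 ≤ G.rank D by omega
  intro hlt
  rw [le_rank_iff (by omega)] at hlt
  obtain ⟨N, hN1, hN2⟩ := hN
  -- A rank above `deg D - 2` would allow an effective `F ∼ D - N` to be subtracted from `D`,
  -- leaving the noneffective class `N`.
  obtain ⟨F, hF, hFN⟩ := hc.linearSystem_nonempty (D := D - N)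
    (by rw [divDeg_sub, hN1, hg]; omega)
  have := hlt F hF (by rw [LinEquiv.divDeg_eq hFN, divDeg_sub, hN1])
  rw [(LinEquiv.sub_left hFN D).linearSystem_eq, sub_sub_cancel] at this
  exact hN2 this

/-- The class of a divisor of degree zero has finite order. -/
theorem addOrderOf_cls_pos (hc : G.IsConnected) {D : G.Div} (h : G.divDeg D = 0) :
    0 < addOrderOf (G.cls D) := by
  classical
  rw [addOrderOf_pos_iff]
  by_contra hinf
  have hinj := injective_nsmul_iff_not_isOfFinAddOrder.2 hinf
  obtain ⟨q⟩ := ‹Nonempty V(G)›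
  have hdeg : ∀ n : ℕ, G.divDeg ((n : ℤ) • D + G.genus • G.pt q) = G.genus := by
    intro n
    rw [divDeg_add, divDeg_zsmul, divDeg_zsmul, divDeg_pt, h]
    ring
  choose F hF hFD using fun n : ℕ =>
    -- Pigeonhole: each `n • D + g • q` has an effective representative of degree `g`, and there are
    -- only finitely many of these.
    hc.linearSystem_nonempty (D := (n : ℤ) • D + G.genus • G.pt q) (hdeg n).ge
  have hmem : ∀ n, F n ∈ Set.Icc (0 : V(G) → ℤ) (fun _ => G.genus) := by
    refine fun n => ⟨hF n, fun x => ?_⟩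
    rw [← hdeg n, ← LinEquiv.divDeg_eq (hFD n)]
    exact Finset.single_le_sum (f := F n) (fun i _ => hF n i) (Finset.mem_univ x)
  obtain ⟨m, n, hmn, e⟩ := (Set.finite_Icc (0 : V(G) → ℤ) fun _ => G.genus).exists_lt_map_eq_of_forall_mem
    hmem
  refine hmn.ne (hinj ?_)
  have h1 : G.cls (F m) = (m : ℤ) • G.cls D + G.genus • G.cls (G.pt q) := hFD m
  have h2 : G.cls (F n) = (n : ℤ) • G.cls D + G.genus • G.cls (G.pt q) := hFD n
  rw [e, h2] at h1
  simpa using h1.symm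

end GenusTwo

end Graph

/-! ### Twists of a divisor and the equivalence -/

namespace Graph

variable {α β : Type*} {G : Graph α β} [Fintype V(G)]

/-- The twist of `D` of degree `j` obtained by subtracting `b` times `v` and adding a multiple
of `u`. -/
noncomputable def twist (G : Graph α β) [Fintype V(G)] (u v : V(G)) (D : G.Div) (b j : ℤ) : G.Div :=
  D + (b + j - G.divDeg D) • G.pt u - b • G.pt v

variable {u v : V(G)}

theorem divDeg_twist (D : G.Div) (b j : ℤ) : G.divDeg (G.twist u v D b j) = j := by
  rw [twist, divDeg_sub, divDeg_add, divDeg_zsmul, divDeg_zsmul, divDeg_pt, divDeg_pt]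
  ring

theorem twist_add_pt_left (D : G.Div) (b j : ℤ) :
    G.twist u v D b j + G.pt u = G.twist u v D b (j + 1) := by
  unfold twist
  module

theorem twist_add_pt_right (D : G.Div) (b j : ℤ) :
    G.twist u v D (b + 1) j + G.pt v = G.twist u v D b (j + 1) := by
  unfold twist
  module

theorem rankDelta_twist (D : G.Div) (b j : ℤ) :
    G.rankDelta u v (G.twist u v D b j) = rankCell (fun b j => G.rank (G.twist u v D b j)) b j := by
  have h1 : G.twist u v D b j - G.pt u = G.twist u v D b (j - 1) := by unfold twist; module
  have h2 : G.twist u v D b j - G.pt v = G.twist u v D (b + 1) (j - 1) := by unfold twist; module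
  have h3 : G.twist u v D b (j - 1) - G.pt v = G.twist u v D (b + 1) (j - 2) := by
    unfold twist; module
  rw [rankDelta, rankCell, h1, h2, h3]

theorem isTransmissionPerm_iff {D : G.Div} {τ : Equiv.Perm ℤ} :
    G.IsTransmissionPerm u v D τ ↔ ∀ a b, (if τ b = a then 1 else 0) =
      rankCell (fun b j => G.rank (G.twist u v D b j)) b (a - b + G.divDeg D) := by
  refine forall₂_congr fun a b => ?_
  rw [← rankDelta_twist, show G.twist u v D b (a - b + G.divDeg D) =
    D + a • G.pt u - b • G.pt v by unfold twist; module]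

theorem rank_twist_add_mul (D : G.Div) (b j t : ℤ) :
    G.rank (G.twist u v D (b + G.torsionOrder u v * t) j) = G.rank (G.twist u v D b j) := by
  apply LinEquiv.rank_eq
  have e : G.twist u v D (b + G.torsionOrder u v * t) j =
      G.twist u v D b j + t • (G.torsionOrder u v • (G.pt u - G.pt v)) := by
    unfold twist
    module
  rw [e]
  change G.cls (G.twist u v D b j) + t • (G.torsionOrder u v • G.cls (G.pt u - G.pt v)) = _
  rw [torsionOrder, addOrderOf_nsmul_eq_zero, smul_zero, add_zero]

theorem twist_pt (w : V(G)) (n : ℕ) :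
    G.twist u v (G.pt w) n 1 = n • (G.pt u - G.pt v) + G.pt w := by
  rw [twist, divDeg_pt]
  module

theorem linEquiv_torsionOrder_nsmul :
    G.LinEquiv (G.torsionOrder u v • G.pt u) (G.torsionOrder u v • G.pt v) := by
  change G.torsionOrder u v • G.cls (G.pt u) = G.torsionOrder u v • G.cls (G.pt v)
  rw [← sub_eq_zero, ← nsmul_sub]
  exact addOrderOf_nsmul_eq_zero (G.cls (G.pt u - G.pt v))

theorem IsRigidlyMarked.hasNoneffective (h : G.IsRigidlyMarked u v) :
    G.HasNoneffective := by
  have : Nonempty V(G) := ⟨u⟩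
  have h1 : ¬ 1 ≤ G.rank (G.pt u + G.pt v) := by rw [h.2]; norm_num
  rw [le_rank_iff (by norm_num)] at h1
  push Not at h1
  obtain ⟨E, -, hE, hne⟩ := h1
  refine ⟨_, ?_, Set.not_nonempty_iff_eq_empty.2 hne⟩
  rw [divDeg_sub, divDeg_add, divDeg_pt, divDeg_pt, hE]
  rfl

variable [Finite E(G)]

theorem IsRigidlyMarked.isRankTable (hc : G.IsConnected) (hg : G.genus = 2)
    (h : G.IsRigidlyMarked u v) (D : G.Div) :
    IsRankTable fun b j => G.rank (G.twist u v D b j) := by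
  have : Nonempty V(G) := ⟨u⟩
  have hN := h.hasNoneffective
  constructor
  · exact fun b j hj => rank_of_divDeg_neg (by rwa [divDeg_twist])
  · exact fun b => rank_of_divDeg_eq_zero (divDeg_twist ..)
  · exact fun b => rank_of_divDeg_eq_one hc hg hN (divDeg_twist ..)
  · exact fun b => rank_of_divDeg_eq_two hc hg hN (divDeg_twist ..)
  · intro b j hj
    rw [rank_of_three_le_divDeg hc hg hN (by rwa [divDeg_twist]), divDeg_twist]
  · intro b j
    rw [← twist_add_pt_left]
    exact rank_le_rank_add_pt ..
  · intro b j
    rw [← twist_add_pt_right]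
    exact rank_le_rank_add_pt ..
  · intro b j
    rw [← twist_add_pt_left]
    exact rank_add_pt_le ..
  · intro b j
    rw [← twist_add_pt_right]
    exact rank_add_pt_le ..
  · intro b j
    have := h.1 D (b + j - G.divDeg D) (-b)
    rw [← rankDelta_twist]
    convert this using 2
    unfold twist
    module
  · intro b hb
    obtain ⟨F, hF, hFD⟩ := zero_le_rank_iff.1 hb.ge
    have hdeg := LinEquiv.divDeg_eq hFD
    rw [divDeg_twist] at hdeg
    rw [eq_zero_of_divDeg_eq_zero hF hdeg] at hFD
    rw [← h.2]
    apply LinEquiv.rank_eq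
    -- Rigidity of the table: if the twist at `(b + 1, 0)` is trivial, the one at `(b, 2)` is
    -- equivalent to `u + v`, which has rank 0.
    have e : G.twist u v D b 2 = G.twist u v D (b + 1) 0 + (G.pt u + G.pt v) := by
      unfold twist
      module
    rw [e]
    change G.cls _ + G.cls (G.pt u + G.pt v) = G.cls (G.pt u + G.pt v)
    rw [← show G.cls 0 = G.cls (G.twist u v D (b + 1) 0) from hFD]
    exact zero_add (G.cls (G.pt u + G.pt v))

/-- The number of `k`-inversions of a transmission permutation is the number of residues `b`
modulo `k` for which the twist of degree one at `b` is effective. -/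
theorem IsRigidlyMarked.exists_kInversion_map (hc : G.IsConnected) (hg : G.genus = 2)
    (h : G.IsRigidlyMarked u v) {D : G.Div} {τ : Equiv.Perm ℤ}
    (hτ : G.IsTransmissionPerm u v D τ) :
    ∃ f : KInversion (G.torsionOrder u v) τ → ZMod (G.torsionOrder u v), Function.Injective f ∧
      Set.range f = (fun b : ℤ => (b : ZMod (G.torsionOrder u v))) ''
        {b | (G.linearSystem (G.twist u v D b 1)).Nonempty} := by
  have : Nonempty V(G) := ⟨u⟩
  have hX := h.isRankTable hc hg D
  obtain ⟨f, hf, hr⟩ := hX.exists_kInversion_map (isTransmissionPerm_iff.1 hτ)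
    (k := G.torsionOrder u v) fun b j t => rank_twist_add_mul D b j t
  refine ⟨f, hf, hr.trans ?_⟩
  congr 1
  ext b
  simp only [Set.mem_ofPred_eq]
  rw [← zero_le_rank_iff]
  rcases hX.one b with e | e <;> omega

theorem IsRigidlyMarked.exists_isTransmissionPerm (hc : G.IsConnected) (hg : G.genus = 2)
    (h : G.IsRigidlyMarked u v) (D : G.Div) : ∃ τ, G.IsTransmissionPerm u v D τ := by
  obtain ⟨τ, hτ⟩ := (h.isRankTable hc hg D).exists_perm (G.divDeg D)
  exact ⟨τ, isTransmissionPerm_iff.2 hτ⟩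

theorem torsionOrder_pos (hc : G.IsConnected) : 0 < G.torsionOrder u v := by
  have : Nonempty V(G) := ⟨u⟩
  exact addOrderOf_cls_pos hc (by rw [divDeg_sub, divDeg_pt, divDeg_pt, sub_self])

theorem IsRigidlyMarked.isNonRecurrent (hc : G.IsConnected) (hg : G.genus = 2)
    (h : G.IsRigidlyMarked u v) (hT : G.HasGeneralTransmission u v (G.torsionOrder u v)) :
    G.IsNonRecurrent (G.pt u - G.pt v) := by
  rintro w n₁ ⟨h1, h1', e1⟩ n₂ ⟨h2, h2', e2⟩
  change n₁ < G.torsionOrder u v at h1'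
  change n₂ < G.torsionOrder u v at h2'
  by_contra hne
  obtain ⟨-, τ, hτ, hfin, hcard⟩ := hT.2.2 (G.pt w)
  obtain ⟨f, hf, hr⟩ := h.exists_kInversion_map hc hg hτ
  -- For `D = w`, the residues `0`, `n₁`, `n₂` are distinct and all have effective degree-one
  -- twists, giving three `k`-inversions.
  have hlt : 2 < (Set.range f).ncard := by
    rw [Set.two_lt_ncard_iff (Set.finite_range f), hr]
    refine ⟨((0 : ℕ) : ZMod _), (n₁ : ZMod _), (n₂ : ZMod _), ⟨(0 : ℕ), ?_, Int.cast_natCast _⟩,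
      ⟨n₁, ?_, Int.cast_natCast _⟩, ⟨n₂, ?_, Int.cast_natCast _⟩, ?_, ?_, ?_⟩
    · rw [Set.mem_ofPred_eq, twist_pt, zero_smul, zero_add]
      exact ⟨G.pt w, pt_nonneg w, rfl⟩
    · rwa [Set.mem_ofPred_eq, twist_pt]
    · rwa [Set.mem_ofPred_eq, twist_pt]
    all_goals
      intro e
      rw [ZMod.natCast_eq_natCast_iff', Nat.mod_eq_of_lt (by omega),
        Nat.mod_eq_of_lt (by omega)] at e
      omega
  rw [← Nat.card_coe_set_eq, Nat.card_range_of_injective hf] at hlt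
  omega

theorem IsRigidlyMarked.hasGeneralTransmission (hc : G.IsConnected) (hg : G.genus = 2)
    (h : G.IsRigidlyMarked u v) (hR : G.IsNonRecurrent (G.pt u - G.pt v)) :
    G.HasGeneralTransmission u v (G.torsionOrder u v) := by
  refine ⟨torsionOrder_pos hc, linEquiv_torsionOrder_nsmul, fun D => ⟨h.1 D, ?_⟩⟩
  have : NeZero (G.torsionOrder u v) := ⟨(torsionOrder_pos hc).ne'⟩
  obtain ⟨τ, hτ⟩ := h.exists_isTransmissionPerm hc hg D
  obtain ⟨f, hf, hr⟩ := h.exists_kInversion_map hc hg hτ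
  refine ⟨τ, hτ, Finite.of_injective f hf, ?_⟩
  rw [hg, ← Nat.card_range_of_injective hf, Nat.card_coe_set_eq]
  by_contra! hlt
  have hlt' : 2 < (Set.range f).ncard := by exact_mod_cast hlt
  rw [Set.two_lt_ncard_iff (Set.toFinite _), hr] at hlt'
  obtain ⟨_, _, _, ⟨b₀, ⟨F, hF, hFD⟩, rfl⟩, ⟨b₁, e1, rfl⟩, ⟨b₂, e2, rfl⟩, h01, h02, h12⟩ := hlt'
  have hdeg := LinEquiv.divDeg_eq hFD
  rw [divDeg_twist] at hdeg
  -- Of three effective residues, `b₀` serves as origin: its effective representative has degree 1,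
  -- hence is a vertex `w`. The other two then give `n ≡ b - b₀` in `{1, …, k - 1}`.
  obtain ⟨w, hw⟩ := exists_pt_le hF (by rw [hdeg]; norm_num)
  have hFw := eq_zero_of_divDeg_eq_zero hw (by rw [divDeg_sub, divDeg_pt, hdeg, sub_self])
  rw [sub_eq_zero] at hFw
  subst hFw
  have kpos : (0 : ℤ) < G.torsionOrder u v := by exact_mod_cast torsionOrder_pos hc
  have key : ∀ b : ℤ, (G.linearSystem (G.twist u v D b 1)).Nonempty →
      (b₀ : ZMod (G.torsionOrder u v)) ≠ b →
      ((b - b₀) % G.torsionOrder u v).toNat ∈ {n : ℕ | 1 ≤ n ∧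
        n < addOrderOf (G.cls (G.pt u - G.pt v)) ∧
        (G.linearSystem (n • (G.pt u - G.pt v) + G.pt w)).Nonempty} := by
    intro b hb hne
    have hmod := Int.emod_nonneg (b - b₀) kpos.ne'
    have hmod' := Int.emod_lt_of_pos (b - b₀) kpos
    obtain ⟨n, hn⟩ := Int.eq_ofNat_of_zero_le hmod
    have hdm := Int.emod_add_mul_ediv (b - b₀) (G.torsionOrder u v)
    rw [hn] at hdm hmod' ⊢
    rw [Int.toNat_natCast]
    refine ⟨?_, by exact_mod_cast hmod', ?_⟩
    · by_contra! hlt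
      refine hne ((ZMod.intCast_eq_intCast_iff_dvd_sub _ _ _).2 ?_)
      rw [← hdm, show n = 0 by omega, Nat.cast_zero, zero_add]
      exact dvd_mul_right _ _
    · have : Nonempty V(G) := ⟨u⟩
      rw [← zero_le_rank_iff] at hb ⊢
      rw [show b = b₀ + n + G.torsionOrder u v * ((b - b₀) / G.torsionOrder u v) by linarith,
        rank_twist_add_mul] at hb
      refine hb.trans_eq (LinEquiv.rank_eq ?_)
      have e : G.twist u v D (b₀ + n) 1 = n • (G.pt u - G.pt v) + G.twist u v D b₀ 1 := by
        unfold twist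
        module
      rw [e]
      change G.cls (n • (G.pt u - G.pt v)) + G.cls (G.twist u v D b₀ 1) =
        G.cls (n • (G.pt u - G.pt v)) + G.cls (G.pt w)
      rw [show G.cls (G.pt w) = G.cls (G.twist u v D b₀ 1) from hFD]
  have heq := hR w (key b₁ e1 h01) (key b₂ e2 h02)
  refine h12 ((ZMod.intCast_eq_intCast_iff_dvd_sub _ _ _).2 ?_)
  have hmod1 := Int.emod_nonneg (b₁ - b₀) kpos.ne'
  have hmod2 := Int.emod_nonneg (b₂ - b₀) kpos.ne'
  have : (b₁ - b₀) % G.torsionOrder u v = (b₂ - b₀) % G.torsionOrder u v := by omega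
  have := Int.ModEq.dvd this
  rwa [sub_sub_sub_cancel_right] at this

end Graph

theorem mainTheorem5 {α β : Type*} (G : Graph α β) [Fintype G.vertexSet] [Finite G.edgeSet]
    [G.Loopless] (hconn : G.IsConnected) (hg : G.genus = 2) (u v : G.vertexSet) (k : ℕ)
    (hk : G.torsionOrder u v = k) (hrigid : G.IsRigidlyMarked u v) :
    G.HasGeneralTransmission u v k ↔ G.IsNonRecurrent (G.pt u - G.pt v) := by
  subst hk
  exact ⟨hrigid.isNonRecurrent hconn hg, hrigid.hasGeneralTransmission hconn hg⟩
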